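/- Let $n\ge 0$ be an integer and let $P\in\mathbf C[z_1^{\pm1},\dots,z_n^{\pm1}]$ be a nonzero Laurent polynomial. For an integer matrix $A=(a_{i,j})\in\mathbf Z^{m\times n}$ put $$P_A(z_1,\dots,z_m):=P\bigl(z_1^{a_{1,1}}\cdots z_m^{a_{m,1}},\;\dots,\;z_1^{a_{1,n}}\cdots z_m^{a_{m,n}}\bigr),\qquad \rho(A):=\min\{\lVert v\rVert_\infty : v\in\mathbf Z^n\setminus\{0\},\ A v=0\},$$ with $\rho(A)=+\infty$ if $A$ has no nonzero integer kernel vector. For a nonzero Laurent polynomial $Q$ in $k$ variables let $$m(Q):=\int_{(\mathbf R/\mathbf Z)^k}\log\bigl|Q(e^{2\pi i t_1},\dots,e^{2\pi i t_k})\bigr|\,dt_1\cdots dt_k$$ be its logarithmic Mahler measure. Let $A_d\in\mathbf Z^{m_d\times n}$ $(d\in\mathbf N)$ be any sequence of integer matrices, with arbitrary numbers of rows $m_d\ge 0$, such that $\lim_{d\to+\infty}\rho(A_d)=+\infty$. Then the integral defining $m(P)$ converges absolutely; for all sufficiently large $d$ the Laurent polynomial $P_{A_d}$ is nonzero and the integral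 defining $m(P_{A_d})$ converges absolutely; and $$\lim_{d\to+\infty}m(P_{A_d})=m(P).$$ -/

import Mathlib

namespace LaurentMahler

open MeasureTheory

/-- Laurent polynomials `ℂ[z₁^{±1}, …, zₙ^{±1}]`: finite linear combinations of the monomials
`z^v = z₁^{v₁} ⋯ zₙ^{vₙ}`, `v ∈ ℤⁿ`, multiplied by convolution. -/
abbrev Laurent (n : ℕ) : Type := AddMonoidAlgebra ℂ (Fin n → ℤ)

/-- The value `P(z) = ∑_v c_v(P) z^v`; meant for points `z` with nonzero coordinates. -/
noncomputable def Laurent.eval {n : ℕ} (P : Laurent n) (z : Fin n → ℂ) : ℂ :=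
  P.coeff.sum fun v c => c * ∏ j, z j ^ v j

/-- The monomial map `z ↦ z^A = (z₁^{a₁ⱼ} ⋯ zₘ^{aₘⱼ})ⱼ` attached to an `m × n` matrix `A`. -/
noncomputable def monomialMap {m n : ℕ} (A : Matrix (Fin m) (Fin n) ℤ) (z : Fin m → ℂ) :
    Fin n → ℂ :=
  fun j => ∏ i, z i ^ A i j

/-- The Laurent polynomial `P_A = P(z^A)` in `m` variables: the monomial `z^v` becomes
`z^{A v}`, and coefficients of equal monomials are added. See `eval_subst`. -/
noncomputable def Laurent.subst {m n : ℕ} (P : Laurent n) (A : Matrix (Fin m) (Fin n) ℤ) :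
    Laurent m :=
  AddMonoidAlgebra.mapDomain (fun v => A.mulVec v) P

/-- `P_A(z) = P(z^A)` for all `z ∈ (ℂ^×)^m`. -/
theorem eval_subst {m n : ℕ} (P : Laurent n) (A : Matrix (Fin m) (Fin n) ℤ) (z : Fin m → ℂ)
    (hz : ∀ i, z i ≠ 0) : (P.subst A).eval z = P.eval (monomialMap A z) := by
  have key : ∀ v : Fin n → ℤ,
      ∏ i, z i ^ (A.mulVec v) i = ∏ j, monomialMap A z j ^ v j := by
    intro v
    have h1 : ∀ i, z i ^ (A.mulVec v) i = ∏ j, z i ^ (A i j * v j) := by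
      intro i
      simp only [Matrix.mulVec, dotProduct]
      induction (Finset.univ : Finset (Fin n)) using Finset.induction_on with
      | empty => simp
      | insert a s ha ih => rw [Finset.sum_insert ha, Finset.prod_insert ha, zpow_add₀ (hz i), ih]
    simp only [h1, monomialMap]
    rw [Finset.prod_comm]
    refine Finset.prod_congr rfl fun j _ => ?_
    rw [← Finset.prod_zpow]
    exact Finset.prod_congr rfl fun i _ => zpow_mul _ _ _
  unfold Laurent.eval Laurent.subst AddMonoidAlgebra.mapDomain
  rw [AddMonoidAlgebra.coeff_ofCoeff, Finsupp.sum_mapDomain_index (by simp)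
    (by intros; ring)]
  simp only [key]

/-- The Haar probability measure on the torus `(ℝ/ℤ)ⁿ`. -/
noncomputable def haarTorus (n : ℕ) : Measure (UnitAddTorus (Fin n)) :=
  Measure.pi fun _ => AddCircle.haarAddCircle

/-- The function `t ↦ log |P(e^{2πi t₁}, …, e^{2πi tₙ})|` on `(ℝ/ℤ)ⁿ`. -/
noncomputable def logAbs {n : ℕ} (P : Laurent n) (t : UnitAddTorus (Fin n)) : ℝ :=
  Real.log ‖P.eval fun j => (AddCircle.toCircle (t j) : ℂ)‖

/-- The logarithmic Mahler measure `m(P)`. -/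
noncomputable def logMahler {n : ℕ} (P : Laurent n) : ℝ :=
  ∫ t, logAbs P t ∂(haarTorus n)

/-- `ρ(A)`: the smallest `ℓ^∞`-norm of a nonzero integer vector in the kernel of `A`, and `∞` if
there is none. The norm on `Fin n → ℤ` is the maximum of the absolute values of the coordinates;
its values are natural numbers, so the infimum is a minimum when the kernel is nonzero. -/
noncomputable def rho {m n : ℕ} (A : Matrix (Fin m) (Fin n) ℤ) : ENNReal :=
  ⨅ v : {v : Fin n → ℤ // A.mulVec v = 0 ∧ v ≠ 0}, ENNReal.ofReal ‖(v : Fin n → ℤ)‖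

end LaurentMahler

/-!
The image of Haar measure under `t ↦ t^{A_d}` converges weakly to Haar measure on the `n`-torus:
a nontrivial character `v` integrates to zero against it as soon as `A_d v ≠ 0`, which holds once
`ρ(A_d) > ‖v‖`, and characters span a dense subspace of the continuous functions
(`tendsto_integral_comp_torusMap`). If `log |P|` were continuous, this would be the whole proof. What
remains is to control the logarithmic singularities uniformly in `d`.

For large `d` the map `v ↦ A_d v` is injective on the support of `P`, so `P` and all the `P_{A_d}`
are sums of the same coefficients times pairwise distinct characters. For such a sum `Q` with `k`
terms, `exists_haarTorus_norm_expSum_lt_le` bounds the measure of `{|Q| < ε}` by a constant times a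
power of `ε`, where constant and exponent depend on `k` and one coefficient only, not on the torus or
the degrees. Instead of derivatives, whose size depends on the degrees, the induction on `k` uses the
twisted difference `Q(t + h) - χ(h) Q(t)`, which removes the term of the character `χ` from `Q`.

By the layer-cake formula (`lintegral_log_tail_le`), replacing `log |Q|` by the continuous function
`log (max |Q| e^{-M})` then changes the integral by an amount that is exponentially small in `M`,
uniformly over this family. This gives integrability, and convergence by letting first `d` and then
`M` tend to infinity.
-/

namespace LaurentMahler

open MeasureTheory

/-! ### Characters of the torus -/

instance isProbabilityMeasure_haarTorus (n : ℕ) : IsProbabilityMeasure (haarTorus n) := by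
  unfold haarTorus; infer_instance

instance isAddHaarMeasure_haarTorus (n : ℕ) : (haarTorus n).IsAddHaarMeasure := by
  unfold haarTorus; infer_instance

/-- The endomorphism `t ↦ ∑ i, vᵢ tᵢ` from the torus to the circle; composing it with
`AddCircle.toCircle` gives the character `UnitAddTorus.mFourier v`. -/
noncomputable def charMap {n : ℕ} (v : Fin n → ℤ) : UnitAddTorus (Fin n) →+ UnitAddCircle where
  toFun t := ∑ i, v i • t i
  map_zero' := by simp
  map_add' s t := by simp [Finset.sum_add_distrib]

theorem charMap_apply {n : ℕ} (v : Fin n → ℤ) (t : UnitAddTorus (Fin n)) :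
    charMap v t = ∑ i, v i • t i := rfl

theorem mFourier_eq_toCircle {n : ℕ} (v : Fin n → ℤ) (t : UnitAddTorus (Fin n)) :
    UnitAddTorus.mFourier v t = AddCircle.toCircle (charMap v t) := by
  have h : ∀ s : Finset (Fin n), (∏ i ∈ s, (AddCircle.toCircle (v i • t i) : ℂ)) =
      AddCircle.toCircle (∑ i ∈ s, v i • t i) := by
    intro s
    induction s using Finset.induction_on with
    | empty => simp
    | insert a s ha ih =>
      rw [Finset.prod_insert ha, Finset.sum_insert ha, ih, AddCircle.toCircle_add, Circle.coe_mul]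
  simpa [UnitAddTorus.mFourier, charMap_apply, fourier_apply] using h Finset.univ

theorem mFourier_add_apply {n : ℕ} (v : Fin n → ℤ) (s t : UnitAddTorus (Fin n)) :
    UnitAddTorus.mFourier v (s + t) = UnitAddTorus.mFourier v s * UnitAddTorus.mFourier v t := by
  simp [mFourier_eq_toCircle, AddCircle.toCircle_add]

theorem norm_mFourier_apply {n : ℕ} (v : Fin n → ℤ) (t : UnitAddTorus (Fin n)) :
    ‖UnitAddTorus.mFourier v t‖ = 1 := by
  rw [mFourier_eq_toCircle]
  exact Circle.norm_coe _

theorem charMap_surjective {n : ℕ} {v : Fin n → ℤ} (hv : v ≠ 0) :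
    Function.Surjective (charMap v) := by
  classical
  intro x
  obtain ⟨i, hi⟩ := Function.ne_iff.1 hv
  refine ⟨Pi.single i (DivisibleBy.div x (v i)), ?_⟩
  rw [charMap_apply, Finset.sum_eq_single i]
  · rw [Pi.single_eq_same]
    exact DivisibleBy.div_cancel x hi
  · intro j _ hj
    rw [Pi.single_eq_of_ne hj, smul_zero]
  · simp

theorem measurePreserving_charMap {n : ℕ} {v : Fin n → ℤ} (hv : v ≠ 0) :
    MeasurePreserving (charMap v) (haarTorus n) (AddCircle.haarAddCircle (T := 1)) := by
  refine AddMonoidHom.measurePreserving ?_ (charMap_surjective hv) (by simp)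
  change Continuous fun t : UnitAddTorus (Fin n) => ∑ i, v i • t i
  fun_prop

theorem integral_mFourier_eq_zero {n : ℕ} {v : Fin n → ℤ} (hv : v ≠ 0) :
    ∫ t, UnitAddTorus.mFourier v t ∂(haarTorus n) = 0 := by
  obtain ⟨h, hh⟩ := charMap_surjective hv ((1 / 2 : ℝ) : UnitAddCircle)
  refine integral_eq_zero_of_add_right_eq_neg (g := h) fun t => ?_
  have hc : (AddCircle.toCircle ((1 / 2 : ℝ) : UnitAddCircle) : ℂ) = -1 := by
    rw [AddCircle.toCircle_apply_mk, Circle.coe_exp]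
    rw [← Complex.exp_pi_mul_I]
    congr 1
    push_cast
    ring
  rw [mFourier_add_apply, mFourier_eq_toCircle v h, hh, hc]
  ring

theorem four_mul_norm_le_norm_toCircle_sub_one (x : UnitAddCircle) :
    4 * ‖x‖ ≤ ‖(AddCircle.toCircle x : ℂ) - 1‖ := by
  obtain ⟨y, hy⟩ := QuotientAddGroup.mk_surjective x
  obtain ⟨z, rfl, hz⟩ : ∃ z : ℝ, (z : UnitAddCircle) = x ∧ |z| ≤ 1 / 2 := by
    refine ⟨y - round y, ?_, abs_sub_round y⟩
    rw [← hy, AddCircle.coe_sub]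
    have : ((round y : ℝ) : UnitAddCircle) = 0 :=
      (AddCircle.coe_eq_zero_iff 1).2 ⟨round y, by simp⟩
    rw [this, sub_zero]
  rw [(AddCircle.norm_coe_eq_abs_iff (1 : ℝ) one_ne_zero).2 (by simpa using hz),
    AddCircle.toCircle_apply_mk, Circle.coe_exp, mul_comm _ Complex.I,
    Complex.norm_exp_I_mul_ofReal_sub_one, norm_mul, Real.norm_eq_abs, Real.norm_eq_abs,
    abs_two]
  have hpi : |2 * Real.pi / 1 * z / 2| = Real.pi * |z| := by
    rw [show 2 * Real.pi / 1 * z / 2 = Real.pi * z by ring, abs_mul, abs_of_pos Real.pi_pos]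
  have h := Real.mul_abs_le_abs_sin (x := 2 * Real.pi / 1 * z / 2)
    (by rw [hpi]; nlinarith [Real.pi_pos])
  rw [hpi] at h
  have h2 : 2 / Real.pi * (Real.pi * |z|) = 2 * |z| := by
    field_simp
  linarith

/-- Two distinct characters are `η`-close only on a set of measure at most `η`, whatever the
dimension of the torus: their quotient pushes Haar measure forward to Haar measure. -/
theorem haarTorus_norm_mFourier_sub_lt_le {n : ℕ} {v w : Fin n → ℤ} (hvw : v ≠ w) (η : ℝ) :
    haarTorus n {h | ‖UnitAddTorus.mFourier v h - UnitAddTorus.mFourier w h‖ < η} ≤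
      ENNReal.ofReal η := by
  have hsub : {h | ‖UnitAddTorus.mFourier v h - UnitAddTorus.mFourier w h‖ < η} ⊆
      charMap (v - w) ⁻¹' Metric.closedBall 0 (η / 4) := by
    intro h hh
    have h1 : UnitAddTorus.mFourier v h - UnitAddTorus.mFourier w h =
        (AddCircle.toCircle (charMap (v - w) h) - 1) * UnitAddTorus.mFourier w h := by
      rw [← mFourier_eq_toCircle, sub_mul, ← UnitAddTorus.mFourier_add, sub_add_cancel, one_mul]
    rw [Set.mem_ofPred_eq, h1, norm_mul, norm_mFourier_apply, mul_one] at hh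
    have h2 := four_mul_norm_le_norm_toCircle_sub_one (charMap (v - w) h)
    rw [Set.mem_preimage, mem_closedBall_zero_iff]
    linarith
  refine (measure_mono hsub).trans ?_
  rw [(measurePreserving_charMap (sub_ne_zero.2 hvw)).measure_preimage
    measurableSet_closedBall.nullMeasurableSet]
  have hvol := AddCircle.volume_closedBall (T := 1) (x := 0) (η / 4)
  rw [AddCircle.volume_eq_smul_haarAddCircle, ENNReal.ofReal_one, one_smul] at hvol
  rw [hvol]
  rcases le_or_gt 0 η with h0 | h0
  · exact ENNReal.ofReal_le_ofReal ((min_le_right _ _).trans (by linarith))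
  · rw [ENNReal.ofReal_of_nonpos ((min_le_right _ _).trans (by linarith))]
    exact zero_le

/-! ### Small values of exponential sums -/

/-- The exponential sum `∑_{i ∈ s} cᵢ χ_{f i}` on the torus, where `χ_v` is the character
`UnitAddTorus.mFourier v`. -/
noncomputable def expSum {ι : Type*} {n : ℕ} (s : Finset ι) (c : ι → ℂ) (f : ι → Fin n → ℤ) :
    C(UnitAddTorus (Fin n), ℂ) :=
  ∑ i ∈ s, c i • UnitAddTorus.mFourier (f i)

theorem expSum_apply {ι : Type*} {n : ℕ} (s : Finset ι) (c : ι → ℂ) (f : ι → Fin n → ℤ)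
    (t : UnitAddTorus (Fin n)) :
    expSum s c f t = ∑ i ∈ s, c i * UnitAddTorus.mFourier (f i) t := by
  simp [expSum, ContinuousMap.sum_apply]

/-- Twisted differencing removes the term of index `j` from an exponential sum. -/
theorem expSum_add_sub {ι : Type*} [DecidableEq ι] {n : ℕ} {s : Finset ι} (c : ι → ℂ)
    (f : ι → Fin n → ℤ) {j : ι} (hj : j ∈ s) (t h : UnitAddTorus (Fin n)) :
    expSum s c f (t + h) - UnitAddTorus.mFourier (f j) h * expSum s c f t =
      expSum (s.erase j)
        (fun i => c i * (UnitAddTorus.mFourier (f i) h - UnitAddTorus.mFourier (f j) h)) f t := by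
  rw [expSum_apply, expSum_apply, expSum_apply, Finset.mul_sum, ← Finset.sum_sub_distrib,
    ← Finset.sum_erase_add _ _ hj]
  rw [add_eq_left.2]
  · refine Finset.sum_congr rfl fun i _ => ?_
    rw [mFourier_add_apply]; ring
  · rw [mFourier_add_apply]; ring

/-- The average over `h` of the measure of `E ∩ (E - h)` is the square of the measure of `E`. -/
theorem lintegral_measure_inter_translate {n : ℕ} {E : Set (UnitAddTorus (Fin n))}
    (hE : MeasurableSet E) :
    ∫⁻ h, haarTorus n {t | t ∈ E ∧ t + h ∈ E} ∂(haarTorus n) = haarTorus n E ^ 2 := by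
  have hmeas : MeasurableSet {p : UnitAddTorus (Fin n) × UnitAddTorus (Fin n) |
      p.2 ∈ E ∧ p.2 + p.1 ∈ E} :=
    (measurable_snd hE).inter ((measurable_snd.add measurable_fst) hE)
  have h1 := Measure.prod_apply (μ := haarTorus n) (ν := haarTorus n) hmeas
  have h2 := Measure.prod_apply_symm (μ := haarTorus n) (ν := haarTorus n) hmeas
  rw [h1] at h2
  refine h2.trans ?_
  have h3 : ∀ t, haarTorus n ((fun h => (h, t)) ⁻¹' {p : UnitAddTorus (Fin n) ×
      UnitAddTorus (Fin n) | p.2 ∈ E ∧ p.2 + p.1 ∈ E}) =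
      E.indicator (fun _ => haarTorus n E) t := by
    intro t
    by_cases ht : t ∈ E
    · rw [Set.indicator_of_mem ht, ← measure_preimage_add (haarTorus n) t E]
      congr 1
      ext h
      simp [ht]
    · simp [ht]
  simp_rw [h3]
  rw [lintegral_indicator_const hE, sq]

/-- An exponential sum with `k + 1` terms is rarely small, uniformly in the dimension of the torus
and in the frequencies, as long as these are pairwise distinct. The proof is by induction on `k`: let
`E` be the set where the sum is smaller than `ε`. If `t` and `t + h` both lie in `E`, the twisted
difference that removes the term `j ≠ i` is smaller than `2 ε` at `t`, and its `i`-th coefficient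
`c i * (χ_{f i}(h) - χ_{f j}(h))` is not small for most `h`. Averaging over `h` bounds the square of
the measure of `E`, which costs a factor `4` in the exponent. -/
theorem exists_haarTorus_norm_expSum_lt_le (k : ℕ) :
    ∃ C δ : ℝ, 1 ≤ C ∧ 0 < δ ∧ δ ≤ 1 ∧ ∀ (ι : Type) (n : ℕ) (s : Finset ι) (c : ι → ℂ)
      (f : ι → Fin n → ℤ), s.card = k + 1 → Set.InjOn f s → ∀ i ∈ s, c i ≠ 0 → ∀ ε : ℝ, 0 < ε →
        haarTorus n {t | ‖expSum s c f t‖ < ε} ≤ ENNReal.ofReal (C * (ε / ‖c i‖) ^ δ) := by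
  classical
  induction k with
  | zero =>
    refine ⟨1, 1, le_rfl, one_pos, le_rfl, ?_⟩
    intro ι n s c f hs _ i hi hci ε hε
    rw [zero_add, Finset.card_eq_one] at hs
    obtain ⟨a, rfl⟩ := hs
    obtain rfl := Finset.mem_singleton.1 hi
    have hn : ∀ t, ‖expSum {i} c f t‖ = ‖c i‖ := fun t => by
      rw [expSum_apply, Finset.sum_singleton, norm_mul, norm_mFourier_apply, mul_one]
    simp only [hn, one_mul, Real.rpow_one]
    rcases le_or_gt ε ‖c i‖ with h | h
    · simp [not_lt.2 h]
    · refine prob_le_one.trans ?_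
      rw [← ENNReal.ofReal_one]
      exact ENNReal.ofReal_le_ofReal ((one_le_div (norm_pos_iff.2 hci)).2 h.le)
  | succ k ih =>
    obtain ⟨C, δ, hC, hδ, hδ1, ih⟩ := ih
    refine ⟨3 * C, δ / 4, by linarith, by positivity, by linarith, ?_⟩
    intro ι n s c f hs hf i hi hci ε hε
    have hcpos : 0 < ‖c i‖ := norm_pos_iff.2 hci
    set x : ℝ := ε / ‖c i‖ with hx
    have hx0 : 0 < x := by positivity
    rcases le_or_gt 1 x with hx1 | hx1
    · refine prob_le_one.trans ?_
      rw [← ENNReal.ofReal_one]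
      refine ENNReal.ofReal_le_ofReal ?_
      have := Real.one_le_rpow hx1 (by positivity : 0 ≤ δ / 4)
      nlinarith
    obtain ⟨j, hj, hji⟩ := Finset.exists_mem_ne (by omega : 1 < s.card) i
    set E : Set (UnitAddTorus (Fin n)) := {t | ‖expSum s c f t‖ < ε} with hEdef
    have hE : MeasurableSet E :=
      (isOpen_lt (by fun_prop) continuous_const).measurableSet
    set B : Set (UnitAddTorus (Fin n)) :=
      {h | ‖UnitAddTorus.mFourier (f i) h - UnitAddTorus.mFourier (f j) h‖ < x ^ (1 / 2 : ℝ)}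
      with hBdef
    have hB : MeasurableSet B :=
      (isOpen_lt (by fun_prop) continuous_const).measurableSet
    -- The threshold `√x` balances the measure of `B` against the bound for one term less, which is
    -- applied with `2 ε` and with the coefficient `c i` shrunk by at most the factor `√x`.
    have hη : 0 < x ^ (1 / 2 : ℝ) := by positivity
    have hne : f i ≠ f j := fun h => hji (hf hi hj h).symm
    set K : ℝ := C * (2 * x ^ (1 / 2 : ℝ)) ^ δ with hK
    have hpt : ∀ h, haarTorus n {t | t ∈ E ∧ t + h ∈ E} ≤
        B.indicator (fun _ => 1) h + ENNReal.ofReal K := by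
      intro h
      by_cases hh : h ∈ B
      · rw [Set.indicator_of_mem hh]
        exact prob_le_one.trans le_self_add
      rw [Set.indicator_of_notMem hh, zero_add]
      have hh' : x ^ (1 / 2 : ℝ) ≤
          ‖UnitAddTorus.mFourier (f i) h - UnitAddTorus.mFourier (f j) h‖ := not_lt.1 hh
      have hsub : {t | t ∈ E ∧ t + h ∈ E} ⊆ {t | ‖expSum (s.erase j) (fun i => c i *
          (UnitAddTorus.mFourier (f i) h - UnitAddTorus.mFourier (f j) h)) f t‖ < 2 * ε} := by
        rintro t ⟨h1, h2⟩
        rw [Set.mem_ofPred_eq, ← expSum_add_sub c f hj]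
        refine (norm_sub_le _ _).trans_lt ?_
        rw [norm_mul, norm_mFourier_apply, one_mul, two_mul]
        exact add_lt_add h2 h1
      refine (measure_mono hsub).trans ((ih ι n (s.erase j) _ f ?_ ?_ i ?_ ?_ (2 * ε)
        (by positivity)).trans (ENNReal.ofReal_le_ofReal ?_))
      · rw [Finset.card_erase_of_mem hj, hs]; rfl
      · exact hf.mono (by simp)
      · exact Finset.mem_erase.2 ⟨hji.symm, hi⟩
      · refine mul_ne_zero hci (norm_pos_iff.1 (hη.trans_le hh'))
      · rw [hK]
        gcongr
        rw [norm_mul, div_le_iff₀ (mul_pos hcpos (hη.trans_le hh'))]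
        have hsq : x ^ (1 / 2 : ℝ) * x ^ (1 / 2 : ℝ) = x := by
          rw [← Real.rpow_add hx0]; norm_num
        have hεx : ε = x * ‖c i‖ := by rw [hx]; field_simp
        calc 2 * ε = 2 * x ^ (1 / 2 : ℝ) * (‖c i‖ * x ^ (1 / 2 : ℝ)) := by
              rw [hεx]; linear_combination (-2 * ‖c i‖) * hsq
          _ ≤ _ := by gcongr
    have hsq : haarTorus n E ^ 2 ≤ ENNReal.ofReal (x ^ (1 / 2 : ℝ) + K) := by
      rw [← lintegral_measure_inter_translate hE]
      refine (lintegral_mono hpt).trans ?_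
      rw [lintegral_add_right _ measurable_const, lintegral_indicator_const hB, lintegral_const,
        measure_univ, mul_one, one_mul, ENNReal.ofReal_add hη.le (by positivity)]
      gcongr
      exact haarTorus_norm_mFourier_sub_lt_le hne _
    have hbound : x ^ (1 / 2 : ℝ) + K ≤ (3 * C * x ^ (δ / 4)) ^ 2 := by
      have h1 : x ^ (1 / 2 : ℝ) ≤ x ^ (δ / 2) :=
        Real.rpow_le_rpow_of_exponent_ge hx0 hx1.le (by linarith)
      have h2 : K ≤ C * (2 * x ^ (δ / 2)) := by
        rw [hK, Real.mul_rpow (by norm_num) hη.le, ← Real.rpow_mul hx0.le]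
        have : (2 : ℝ) ^ δ ≤ 2 := by
          simpa using Real.rpow_le_rpow_of_exponent_le one_le_two hδ1
        rw [show 1 / 2 * δ = δ / 2 by ring]
        gcongr
      have h3 : (x ^ (δ / 4)) ^ 2 = x ^ (δ / 2) := by
        rw [sq, ← Real.rpow_add hx0]; ring_nf
      have h4 : 0 < x ^ (δ / 2) := by positivity
      rw [mul_pow, h3]
      nlinarith [mul_pos h4 (by linarith : 0 < C), mul_nonneg h4.le (sub_nonneg.2 hC),
        mul_nonneg (mul_nonneg h4.le (sub_nonneg.2 hC)) (by linarith : 0 ≤ C)]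
    have hfin := hsq.trans (ENNReal.ofReal_le_ofReal hbound)
    rw [ENNReal.ofReal_pow (by positivity)] at hfin
    exact (ENNReal.pow_le_pow_left_iff two_ne_zero).1 hfin

/-! ### Truncation of the logarithm -/

section Truncation

variable {α : Type*} [MeasurableSpace α] {μ : Measure α} {q : α → ℝ} {K δ : ℝ}

theorem log_eq_log_max_sub {y : ℝ} (hy : 0 < y) (M : ℝ) :
    Real.log y = Real.log (max y (Real.exp (-M))) - max (-M - Real.log y) 0 := by
  rcases le_total y (Real.exp (-M)) with h | h
  · have h1 : Real.log y ≤ -M := (Real.log_le_iff_le_exp hy).2 h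
    rw [max_eq_right h, max_eq_left (by linarith), Real.log_exp]
    ring
  · have h1 : -M ≤ Real.log y := (Real.le_log_iff_exp_le hy).2 h
    rw [max_eq_left h, max_eq_right (by linarith), sub_zero]

theorem ae_pos_of_measure_lt_le (hδ : 0 < δ)
    (h : ∀ ε : ℝ, 0 < ε → μ {x | q x < ε} ≤ ENNReal.ofReal (K * ε ^ δ)) :
    ∀ᵐ x ∂μ, 0 < q x := by
  have h0 : μ {x | ¬ 0 < q x} ≤ 0 := by
    have hlim : Filter.Tendsto (fun ε : ℝ => ENNReal.ofReal (K * ε ^ δ))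
        (nhdsWithin 0 (Set.Ioi 0)) (nhds 0) := by
      have h1 : Filter.Tendsto (fun ε : ℝ => K * ε ^ δ) (nhds 0) (nhds (K * 0 ^ δ)) :=
        ((Real.continuousAt_rpow_const 0 δ (Or.inr hδ.le)).tendsto).const_mul K
      rw [Real.zero_rpow hδ.ne', mul_zero] at h1
      simpa using (ENNReal.tendsto_ofReal h1).mono_left nhdsWithin_le_nhds
    refine ge_of_tendsto hlim ?_
    filter_upwards [self_mem_nhdsWithin] with ε hε
    exact (measure_mono fun x hx => (not_lt.1 hx).trans_lt hε).trans (h ε hε)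
  exact ae_iff.2 (le_antisymm h0 zero_le)

theorem ae_nonneg_log_tail (M : ℝ) : 0 ≤ᵐ[μ] fun x => max (-M - Real.log (q x)) 0 :=
  Filter.Eventually.of_forall fun _ => le_max_right _ _

/-- Layer-cake estimate of the part of `log q` below `-M`. -/
theorem lintegral_log_tail_le (hq : Measurable q) (hq0 : ∀ x, 0 ≤ q x) (hK : 0 ≤ K)
    (hδ : 0 < δ) (h : ∀ ε : ℝ, 0 < ε → μ {x | q x < ε} ≤ ENNReal.ofReal (K * ε ^ δ))
    {M : ℝ} (hM : 0 ≤ M) :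
    ∫⁻ x, ENNReal.ofReal (max (-M - Real.log (q x)) 0) ∂μ ≤
      ENNReal.ofReal (K * Real.exp (-(δ * M)) / δ) := by
  rw [lintegral_eq_lintegral_meas_lt μ (ae_nonneg_log_tail M) (by fun_prop)]
  have hint : IntegrableOn (fun u : ℝ => K * Real.exp (-(δ * M)) * Real.exp (-δ * u))
      (Set.Ioi 0) := (integrableOn_exp_mul_Ioi (neg_lt_zero.2 hδ) 0).const_mul _
  have hval : ∫ u in Set.Ioi (0 : ℝ), K * Real.exp (-(δ * M)) * Real.exp (-δ * u) =
      K * Real.exp (-(δ * M)) / δ := by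
    rw [integral_const_mul, integral_exp_mul_Ioi (neg_lt_zero.2 hδ)]
    simp [div_eq_mul_inv]
  rw [← hval, ofReal_integral_eq_lintegral_ofReal hint
    (Filter.Eventually.of_forall fun u => by positivity)]
  refine setLIntegral_mono' measurableSet_Ioi fun u hu => ?_
  have hu0 : (0 : ℝ) < u := hu
  have hsub : {x | u < max (-M - Real.log (q x)) 0} ⊆ {x | q x < Real.exp (-(M + u))} := by
    intro x (hx : u < max (-M - Real.log (q x)) 0)
    rcases lt_max_iff.1 hx with h1 | h1
    · rcases (hq0 x).eq_or_lt with h2 | h2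
      -- the convention `log 0 = 0` keeps the zeros of `q` out of the tail
      · rw [← h2, Real.log_zero] at h1
        linarith
      · exact (Real.log_lt_iff_lt_exp h2).1 (by linarith)
    · exact absurd h1 hu0.not_gt
  refine (measure_mono hsub).trans ((h _ (Real.exp_pos _)).trans (le_of_eq ?_))
  rw [← Real.exp_mul, mul_assoc, ← Real.exp_add]
  ring_nf

theorem integrable_log_tail (hq : Measurable q) (hq0 : ∀ x, 0 ≤ q x) (hK : 0 ≤ K)
    (hδ : 0 < δ) (h : ∀ ε : ℝ, 0 < ε → μ {x | q x < ε} ≤ ENNReal.ofReal (K * ε ^ δ))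
    {M : ℝ} (hM : 0 ≤ M) :
    Integrable (fun x => max (-M - Real.log (q x)) 0) μ := by
  refine ⟨Measurable.aestronglyMeasurable (by fun_prop), ?_⟩
  rw [hasFiniteIntegral_iff_ofReal (ae_nonneg_log_tail M)]
  exact (lintegral_log_tail_le hq hq0 hK hδ h hM).trans_lt ENNReal.ofReal_lt_top

variable [IsFiniteMeasure μ]

theorem integrable_log_max (hq : Measurable q) {R : ℝ} (hR : ∀ x, q x ≤ R) (M : ℝ) :
    Integrable (fun x => Real.log (max (q x) (Real.exp (-M)))) μ := by
  refine Integrable.of_mem_Icc (-M) (Real.log (max R (Real.exp (-M)))) (by fun_prop)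
    (Filter.Eventually.of_forall fun x => ⟨?_, ?_⟩)
  · exact (Real.le_log_iff_exp_le (lt_max_of_lt_right (Real.exp_pos _))).2 (le_max_right _ _)
  · exact Real.log_le_log (lt_max_of_lt_right (Real.exp_pos _)) (max_le_max_right _ (hR x))

theorem integrable_log_of_measure_lt_le (hq : Measurable q) (hq0 : ∀ x, 0 ≤ q x)
    {R : ℝ} (hR : ∀ x, q x ≤ R) (hK : 0 ≤ K) (hδ : 0 < δ)
    (h : ∀ ε : ℝ, 0 < ε → μ {x | q x < ε} ≤ ENNReal.ofReal (K * ε ^ δ)) :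
    Integrable (fun x => Real.log (q x)) μ := by
  refine ((integrable_log_max hq hR 0).sub (integrable_log_tail hq hq0 hK hδ h le_rfl)).congr ?_
  filter_upwards [ae_pos_of_measure_lt_le hδ h] with x hx
  exact (log_eq_log_max_sub hx 0).symm

/-- The error of truncating `log q` at height `-M` depends only on `K`, `δ` and `M`. -/
theorem abs_integral_log_sub_le (hq : Measurable q) (hq0 : ∀ x, 0 ≤ q x)
    {R : ℝ} (hR : ∀ x, q x ≤ R) (hK : 0 ≤ K) (hδ : 0 < δ)
    (h : ∀ ε : ℝ, 0 < ε → μ {x | q x < ε} ≤ ENNReal.ofReal (K * ε ^ δ))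
    {M : ℝ} (hM : 0 ≤ M) :
    |∫ x, Real.log (q x) ∂μ - ∫ x, Real.log (max (q x) (Real.exp (-M))) ∂μ| ≤
      K * Real.exp (-(δ * M)) / δ := by
  have htail := integrable_log_tail hq hq0 hK hδ h hM
  have h1 : ∫ x, Real.log (q x) ∂μ = ∫ x, Real.log (max (q x) (Real.exp (-M))) ∂μ -
      ∫ x, max (-M - Real.log (q x)) 0 ∂μ := by
    rw [← integral_sub (integrable_log_max hq hR M) htail]
    refine integral_congr_ae ?_
    filter_upwards [ae_pos_of_measure_lt_le hδ h] with x hx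
    exact log_eq_log_max_sub hx M
  have h2 : 0 ≤ ∫ x, max (-M - Real.log (q x)) 0 ∂μ :=
    integral_nonneg fun x => le_max_right _ _
  rw [h1, sub_sub_cancel_left, abs_neg, abs_of_nonneg h2,
    integral_eq_lintegral_of_nonneg_ae (ae_nonneg_log_tail M) htail.aestronglyMeasurable]
  exact ENNReal.toReal_le_of_le_ofReal (by positivity)
    (lintegral_log_tail_le hq hq0 hK hδ h hM)

end Truncation

/-! ### Equidistribution of the images of the monomial maps -/

/-- The additive form of the monomial map: `t ↦ (∑ i, aᵢⱼ tᵢ)ⱼ`. -/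
noncomputable def torusMap {m n : ℕ} (A : Matrix (Fin m) (Fin n) ℤ) :
    C(UnitAddTorus (Fin m), UnitAddTorus (Fin n)) where
  toFun t j := ∑ i, A i j • t i
  continuous_toFun := by fun_prop

theorem mFourier_torusMap {m n : ℕ} (A : Matrix (Fin m) (Fin n) ℤ) (v : Fin n → ℤ)
    (t : UnitAddTorus (Fin m)) :
    UnitAddTorus.mFourier v (torusMap A t) = UnitAddTorus.mFourier (A.mulVec v) t := by
  rw [mFourier_eq_toCircle, mFourier_eq_toCircle, charMap_apply, charMap_apply]
  congr 2
  simp only [torusMap, ContinuousMap.coe_mk, Matrix.mulVec, dotProduct, Finset.smul_sum,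
    Finset.sum_smul]
  rw [Finset.sum_comm]
  refine Finset.sum_congr rfl fun i _ => Finset.sum_congr rfl fun j _ => ?_
  rw [smul_smul, mul_comm]

theorem eventually_mulVec_ne_zero {n : ℕ} {m : ℕ → ℕ}
    {A : (d : ℕ) → Matrix (Fin (m d)) (Fin n) ℤ}
    (hA : Filter.Tendsto (fun d => rho (A d)) Filter.atTop (nhds ⊤))
    {v : Fin n → ℤ} (hv : v ≠ 0) : ∀ᶠ d in Filter.atTop, (A d).mulVec v ≠ 0 := by
  filter_upwards [hA.eventually (lt_mem_nhds (ENNReal.ofReal_lt_top (r := ‖v‖)))] with d hd h0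
  exact hd.not_ge (iInf_le _ (⟨v, h0, hv⟩ : {v : Fin n → ℤ // (A d).mulVec v = 0 ∧ v ≠ 0}))

/-- The images of Haar measure under the monomial maps of `A d` converge weakly to Haar measure:
each fixed nontrivial character is eventually pulled back to a nontrivial one. -/
theorem tendsto_integral_comp_torusMap {n : ℕ} {m : ℕ → ℕ}
    {A : (d : ℕ) → Matrix (Fin (m d)) (Fin n) ℤ}
    (hA : Filter.Tendsto (fun d => rho (A d)) Filter.atTop (nhds ⊤))
    (F : C(UnitAddTorus (Fin n), ℂ)) :
    Filter.Tendsto (fun d => ∫ t, F (torusMap (A d) t) ∂(haarTorus (m d))) Filter.atTop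
      (nhds (∫ t, F t ∂(haarTorus n))) := by
  have hint : ∀ {k : ℕ} (G : C(UnitAddTorus (Fin k), ℂ)), Integrable G (haarTorus k) :=
    fun G => G.continuous.integrable_of_hasCompactSupport (HasCompactSupport.of_compactSpace _)
  have hspan : ∀ G ∈ Submodule.span ℂ (Set.range (UnitAddTorus.mFourier (d := Fin n))),
      Filter.Tendsto (fun d => ∫ t, G (torusMap (A d) t) ∂(haarTorus (m d))) Filter.atTop
        (nhds (∫ t, G t ∂(haarTorus n))) := by
    intro G hG
    induction hG using Submodule.span_induction with
    | mem G hG =>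
      obtain ⟨v, rfl⟩ := hG
      simp only [mFourier_torusMap]
      rcases eq_or_ne v 0 with rfl | hv
      · simp [UnitAddTorus.mFourier_zero]
      · rw [integral_mFourier_eq_zero hv]
        refine tendsto_const_nhds.congr' ?_
        filter_upwards [eventually_mulVec_ne_zero hA hv] with d hd
        exact (integral_mFourier_eq_zero hd).symm
    | zero => simp
    | add G H _ _ hG hH =>
      simp only [ContinuousMap.add_apply]
      rw [integral_add (hint G) (hint H)]
      refine (hG.add hH).congr fun d => ?_
      exact (integral_add (hint (G.comp (torusMap (A d)))) (hint (H.comp (torusMap (A d))))).symm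
    | smul a G _ hG =>
      simp only [ContinuousMap.smul_apply, integral_smul]
      exact hG.const_smul a
  have hbound : ∀ {k : ℕ} (G H : C(UnitAddTorus (Fin n), ℂ))
      (φ : C(UnitAddTorus (Fin k), UnitAddTorus (Fin n))),
      dist (∫ t, G (φ t) ∂(haarTorus k)) (∫ t, H (φ t) ∂(haarTorus k)) ≤ dist G H := by
    intro k G H φ
    have hsub : ∫ t, (G (φ t) - H (φ t)) ∂(haarTorus k) =
        ∫ t, G (φ t) ∂(haarTorus k) - ∫ t, H (φ t) ∂(haarTorus k) :=
      integral_sub (hint (G.comp φ)) (hint (H.comp φ))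
    rw [dist_eq_norm, ← hsub]
    have := norm_integral_le_of_norm_le_const (μ := haarTorus k) (C := dist G H)
      (f := fun t => G (φ t) - H (φ t)) (Filter.Eventually.of_forall fun t => by
        rw [← dist_eq_norm]; exact ContinuousMap.dist_apply_le_dist (f := G) (g := H) (φ t))
    simpa using this
  refine Metric.tendsto_nhds.2 fun ε hε => ?_
  have hF : F ∈ closure (Submodule.span ℂ
      (Set.range (UnitAddTorus.mFourier (d := Fin n))) : Set C(UnitAddTorus (Fin n), ℂ)) := by
    rw [← Submodule.topologicalClosure_coe, UnitAddTorus.span_mFourier_closure_eq_top]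
    trivial
  obtain ⟨G, hG, hFG⟩ := Metric.mem_closure_iff.1 hF (ε / 3) (by positivity)
  filter_upwards [Metric.tendsto_nhds.1 (hspan G hG) (ε / 3) (by positivity)] with d hd
  have h1 := hbound F G (torusMap (A d))
  have h2 := hbound G F (ContinuousMap.id _)
  rw [dist_comm G F] at h2
  simp only [ContinuousMap.id_apply] at h2
  have h3 := dist_triangle4 (∫ t, F (torusMap (A d) t) ∂(haarTorus (m d)))
    (∫ t, G (torusMap (A d) t) ∂(haarTorus (m d))) (∫ t, G t ∂(haarTorus n))
    (∫ t, F t ∂(haarTorus n))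
  linarith

/-! ### Mahler measures -/

theorem eval_toCircle_eq_expSum {n : ℕ} (P : Laurent n) (t : UnitAddTorus (Fin n)) :
    P.eval (fun j => (AddCircle.toCircle (t j) : ℂ)) =
      expSum P.coeff.support P.coeff id t := by
  rw [expSum_apply, Laurent.eval, Finsupp.sum]
  refine Finset.sum_congr rfl fun v _ => ?_
  congr 1
  simp only [UnitAddTorus.mFourier, ContinuousMap.coe_mk, id_eq, fourier_apply,
    AddCircle.toCircle_zsmul, Circle.coe_zpow]

theorem monomialMap_toCircle {m n : ℕ} (A : Matrix (Fin m) (Fin n) ℤ)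
    (t : UnitAddTorus (Fin m)) :
    monomialMap A (fun i => (AddCircle.toCircle (t i) : ℂ)) =
      fun j => (AddCircle.toCircle (torusMap A t j) : ℂ) := by
  funext j
  have h := mFourier_eq_toCircle (fun i => A i j) t
  simp only [UnitAddTorus.mFourier, ContinuousMap.coe_mk, fourier_apply,
    AddCircle.toCircle_zsmul, Circle.coe_zpow] at h
  exact h

theorem logAbs_eq_log_norm_expSum {n : ℕ} (P : Laurent n) (t : UnitAddTorus (Fin n)) :
    logAbs P t = Real.log ‖expSum P.coeff.support P.coeff id t‖ := by
  rw [logAbs, eval_toCircle_eq_expSum]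

theorem expSum_torusMap {m n : ℕ} (P : Laurent n) (A : Matrix (Fin m) (Fin n) ℤ)
    (t : UnitAddTorus (Fin m)) :
    expSum P.coeff.support P.coeff id (torusMap A t) =
      expSum P.coeff.support P.coeff A.mulVec t := by
  simp only [expSum_apply, mFourier_torusMap, id_eq]

theorem logAbs_subst_eq_log_norm_expSum {m n : ℕ} (P : Laurent n)
    (A : Matrix (Fin m) (Fin n) ℤ) (t : UnitAddTorus (Fin m)) :
    logAbs (P.subst A) t = Real.log ‖expSum P.coeff.support P.coeff A.mulVec t‖ := by
  rw [logAbs, eval_subst P A _ fun i => Circle.coe_ne_zero _, monomialMap_toCircle,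
    eval_toCircle_eq_expSum, expSum_torusMap]

theorem eventually_injOn_mulVec {n : ℕ} {m : ℕ → ℕ}
    {A : (d : ℕ) → Matrix (Fin (m d)) (Fin n) ℤ}
    (hA : Filter.Tendsto (fun d => rho (A d)) Filter.atTop (nhds ⊤))
    (s : Finset (Fin n → ℤ)) : ∀ᶠ d in Filter.atTop, Set.InjOn (A d).mulVec s := by
  have h : ∀ᶠ d in Filter.atTop, ∀ v ∈ s, ∀ w ∈ s, v - w ≠ 0 → (A d).mulVec (v - w) ≠ 0 := by
    simp only [Filter.eventually_all_finset, Filter.eventually_imp_distrib_left]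
    exact fun v _ w _ hvw => eventually_mulVec_ne_zero hA hvw
  filter_upwards [h] with d hd v hv w hw hvw
  by_contra hne
  refine hd v hv w hw (sub_ne_zero.2 hne) ?_
  rw [Matrix.mulVec_sub, hvw, sub_self]

theorem subst_ne_zero {m n : ℕ} {P : Laurent n} (hP : P ≠ 0) {A : Matrix (Fin m) (Fin n) ℤ}
    (hA : Set.InjOn A.mulVec P.coeff.support) : P.subst A ≠ 0 := by
  obtain ⟨v, hv⟩ : P.coeff.support.Nonempty := by
    rw [Finsupp.support_nonempty_iff]
    exact fun h => hP (AddMonoidAlgebra.coeff_injective h)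
  intro h0
  have h1 := Finsupp.mapDomain_apply' (S := (P.coeff.support : Set (Fin n → ℤ))) P.coeff
    subset_rfl hA hv
  have h2 : Finsupp.mapDomain A.mulVec P.coeff = 0 :=
    congrArg AddMonoidAlgebra.coeff h0
  rw [h2] at h1
  exact Finsupp.mem_support_iff.1 hv h1.symm

theorem norm_expSum_le {ι : Type*} {n : ℕ} (s : Finset ι) (c : ι → ℂ) (f : ι → Fin n → ℤ)
    (t : UnitAddTorus (Fin n)) : ‖expSum s c f t‖ ≤ ∑ i ∈ s, ‖c i‖ := by
  rw [expSum_apply]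
  refine (norm_sum_le _ _).trans (le_of_eq (Finset.sum_congr rfl fun i _ => ?_))
  rw [norm_mul, norm_mFourier_apply, mul_one]

/-- The bound on small values in terms of the coefficients alone: the constants serve every torus
and every choice of distinct frequencies. -/
theorem exists_haarTorus_norm_expSum_lt_le_mul_rpow {ι : Type} {s : Finset ι} {c : ι → ℂ} {i : ι}
    (hi : i ∈ s) (hc : c i ≠ 0) :
    ∃ K δ : ℝ, 0 ≤ K ∧ 0 < δ ∧ ∀ (n : ℕ) (f : ι → Fin n → ℤ), Set.InjOn f s →
      ∀ ε : ℝ, 0 < ε → haarTorus n {t | ‖expSum s c f t‖ < ε} ≤ ENNReal.ofReal (K * ε ^ δ) := by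
  have hcard := Finset.card_pos.2 ⟨i, hi⟩
  obtain ⟨C, δ, hC, hδ, -, h⟩ := exists_haarTorus_norm_expSum_lt_le (s.card - 1)
  refine ⟨C / ‖c i‖ ^ δ, δ, by positivity, hδ, fun n f hf ε hε => ?_⟩
  refine (h ι n s c f (by omega) hf i hi hc ε hε).trans (le_of_eq ?_)
  rw [Real.div_rpow hε.le (norm_nonneg _)]
  ring_nf

end LaurentMahler

open LaurentMahler in
/-- Mahler measures of monomial substitutions `P_{A_d}` with `ρ(A_d) → ∞` converge to that of `P`.
The first two conjuncts say that the Mahler measures involved are convergent integrals of nonzero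
Laurent polynomials, the second one for all large `d`. -/
theorem theorem3p1 (n : ℕ) (P : Laurent n) (hP : P ≠ 0) (m : ℕ → ℕ)
    (A : (d : ℕ) → Matrix (Fin (m d)) (Fin n) ℤ)
    (hA : Filter.Tendsto (fun d => rho (A d)) Filter.atTop (nhds ⊤)) :
    MeasureTheory.Integrable (logAbs P) (haarTorus n) ∧
    (∀ᶠ d in Filter.atTop, P.subst (A d) ≠ 0 ∧
      MeasureTheory.Integrable (logAbs (P.subst (A d))) (haarTorus (m d))) ∧
    Filter.Tendsto (fun d => logMahler (P.subst (A d))) Filter.atTop (nhds (logMahler P)) := by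
  obtain ⟨v, hv⟩ : P.coeff.support.Nonempty := by
    rw [Finsupp.support_nonempty_iff]
    exact fun h => hP (AddMonoidAlgebra.coeff_injective h)
  obtain ⟨K, δ, hK, hδ, hsmall⟩ := exists_haarTorus_norm_expSum_lt_le_mul_rpow (c := P.coeff) hv
    (Finsupp.mem_support_iff.1 hv)
  have hmeas : ∀ (k : ℕ) (f : (Fin n → ℤ) → Fin k → ℤ),
      Measurable fun t => ‖expSum P.coeff.support P.coeff f t‖ :=
    fun k f => (expSum P.coeff.support P.coeff f).continuous.norm.measurable
  have hinj := eventually_injOn_mulVec hA P.coeff.support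
  have hint : ∀ (k : ℕ) (f : (Fin n → ℤ) → Fin k → ℤ), Set.InjOn f P.coeff.support →
      MeasureTheory.Integrable
        (fun t => Real.log ‖expSum P.coeff.support P.coeff f t‖) (haarTorus k) :=
    fun k f hf => integrable_log_of_measure_lt_le (hmeas k f) (fun _ => norm_nonneg _)
      (norm_expSum_le _ _ _) hK hδ (hsmall k f hf)
  have htrunc : ∀ (k : ℕ) (f : (Fin n → ℤ) → Fin k → ℤ), Set.InjOn f P.coeff.support →
      ∀ M : ℝ, 0 ≤ M → |∫ t, Real.log ‖expSum P.coeff.support P.coeff f t‖ ∂(haarTorus k) -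
        ∫ t, Real.log (max ‖expSum P.coeff.support P.coeff f t‖ (Real.exp (-M)))
          ∂(haarTorus k)| ≤ K * Real.exp (-(δ * M)) / δ :=
    fun k f hf M hM => abs_integral_log_sub_le (hmeas k f) (fun _ => norm_nonneg _)
      (norm_expSum_le _ _ _) hK hδ (hsmall k f hf) hM
  have hlim : ∀ M : ℝ, Filter.Tendsto (fun d => ∫ t, Real.log (max
      ‖expSum P.coeff.support P.coeff (A d).mulVec t‖ (Real.exp (-M))) ∂(haarTorus (m d)))
      Filter.atTop (nhds (∫ t, Real.log (max
        ‖expSum P.coeff.support P.coeff id t‖ (Real.exp (-M))) ∂(haarTorus n))) := by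
    intro M
    have hpos : ∀ t : UnitAddTorus (Fin n),
        max ‖expSum P.coeff.support P.coeff id t‖ (Real.exp (-M)) ≠ 0 :=
      fun t => (lt_max_of_lt_right (Real.exp_pos _)).ne'
    have h := tendsto_integral_comp_torusMap hA
      ⟨fun t => ((Real.log (max ‖expSum P.coeff.support P.coeff id t‖ (Real.exp (-M))) : ℝ) : ℂ),
        Complex.continuous_ofReal.comp (Continuous.log (by fun_prop) hpos)⟩
    simp only [ContinuousMap.coe_mk, expSum_torusMap, integral_complex_ofReal] at h
    exact (Complex.continuous_re.tendsto _).comp h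
  refine ⟨?_, ?_, ?_⟩
  · exact (hint n id (Set.injOn_id _)).congr
      (Filter.Eventually.of_forall fun t => (logAbs_eq_log_norm_expSum P t).symm)
  · filter_upwards [hinj] with d hd
    exact ⟨subst_ne_zero hP hd, (hint (m d) _ hd).congr
      (Filter.Eventually.of_forall fun t => (logAbs_subst_eq_log_norm_expSum P (A d) t).symm)⟩
  · simp only [logMahler, logAbs_subst_eq_log_norm_expSum, logAbs_eq_log_norm_expSum P]
    refine Metric.tendsto_nhds.2 fun ε hε => ?_
    have hdecay : Filter.Tendsto (fun M : ℝ => K * Real.exp (-(δ * M)) / δ) Filter.atTop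
        (nhds 0) := by
      have h1 : Filter.Tendsto (fun M : ℝ => Real.exp (-(δ * M))) Filter.atTop (nhds 0) :=
        Real.tendsto_exp_neg_atTop_nhds_zero.comp (Filter.tendsto_id.const_mul_atTop hδ)
      simpa using (h1.const_mul K).div_const δ
    obtain ⟨M, hM, hMε⟩ := ((Filter.eventually_ge_atTop (0 : ℝ)).and
      (hdecay.eventually_lt_const (by positivity : 0 < ε / 3))).exists
    filter_upwards [hinj, Metric.tendsto_nhds.1 (hlim M) (ε / 3) (by positivity)] with d hd hd'
    have h1 := htrunc (m d) _ hd M hM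
    have h2 := htrunc n id (Set.injOn_id _) M hM
    rw [Real.dist_eq, abs_lt] at hd' ⊢
    rw [abs_le] at h1 h2
    constructor <;> linarith
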